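/- For every integer $n\ge 110$ with $n\equiv 26 \pmod{42}$ there exists a (finite, simple, undirected) planar graph $G$ on exactly $n$ vertices that contains neither the complete graph $K_4$ nor the cycle $C_7$ on $7$ vertices as a (not necessarily induced) subgraph, and that has exactly $$e(G)=\frac{18}{7}n-\frac{48}{7}$$ edges. -/

import Mathlib

/-- A drawing of the graph `G` in the Euclidean plane without crossings: distinct vertices are
distinct points, every edge is a simple arc joining the points of its two ends, and an arc contains
no vertex point besides its two ends and has no point in common with another arc besides
vertex points (which are then common ends). -/
structure PlaneEmbedding {V : Type*} (G : SimpleGraph V) where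
  /-- the point that represents a vertex -/
  point : V → EuclideanSpace ℝ (Fin 2)
  point_injective : Function.Injective point
  /-- the arc that represents an edge -/
  arc : G.edgeSet → C(unitInterval, EuclideanSpace ℝ (Fin 2))
  arc_injective : ∀ e, Function.Injective (arc e)
  arc_ends : ∀ e, s(arc e 0, arc e 1) = Sym2.map point (e : Sym2 V)
  arc_avoids_points : ∀ e t, arc e t ∈ Set.range point → t = 0 ∨ t = 1
  arcs_disjoint : ∀ e f, e ≠ f → ∀ s t, arc e s = arc f t → arc e s ∈ Set.range point

/-- A graph is planar if it can be drawn in the plane without crossings. -/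
def IsPlanar {V : Type*} (G : SimpleGraph V) : Prop :=
  Nonempty (PlaneEmbedding G)

/-! ### An infinite tube of octahedra

Octahedra (blocks) with vertices `0, …, 5`, where `i` and `i + 3` are opposite and the corners
`0, 1, 2` bound the outer face, are glued along corners.  The pattern of the gluing is a honeycomb
in which one of the three parallel classes of edges is subdivided, rolled up to a cylinder along
the vector `(2, -1)`, which makes it a helix: blocks and vertices are indexed by an integer and a
type. -/

/-! An octahedron is planar, has 12 edges, contains no `K_4`, and has too few vertices for `C_7`.
Octahedra are glued at corners along a subdivided honeycomb. Two edges of each hexagon are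
subdivided, so going round it takes 8 blocks; the tube is wide enough that no shorter circuit winds
around it (`walkEnds_not_closed`). Hence a cycle of length at most 7 stays inside one block
(`closed_block_walk`), which excludes `C_7`. It also puts all edges of a `K_4` in one block, where
there is none.

The periodic straight-line drawing of the gluing passes to the quotient by a translation, a
cylinder, which the exponential function maps onto the punctured plane (`isPlanar_octahedronTube`).

One unit of length of the tube has 14 vertices and 3 blocks, thus 36 edges: the ratio is 18/7.
Cutting out `N` units with suitable ends leaves whole blocks only, with 14N - 2 vertices and 12(3N -
1) edges (`image_edgeSet`), and these numbers satisfy the formula. -/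

/-- The edges of the octahedron. -/
def octahedronEdges : Finset (Fin 6 × Fin 6) :=
  Finset.univ.filter fun e => e.1 < e.2 ∧ e.2 ≠ e.1 + 3

/-- The type of the `i`-th vertex of a block of type `c`. -/
def vertexType (c : Fin 3) (i : Fin 6) : Fin 14 :=
  (![![0, 1, 2, 4, 5, 6], ![0, 3, 1, 7, 8, 9], ![2, 3, 10, 11, 12, 13]] c) i

/-- The lattice cell of the `i`-th vertex of a block of type `c` in the cell `(0, 0)`. -/
def vertexCell (c : Fin 3) (i : Fin 6) : ℤ × ℤ :=
  if c = 0 ∧ i = 2 then (1, 0) else if c = 1 ∧ i = 2 then (0, 1) else (0, 0)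

/-- The index on the tube of the cell `vertexCell c i`. -/
def vertexOffset (c : Fin 3) (i : Fin 6) : ℤ :=
  (vertexCell c i).1 + 2 * (vertexCell c i).2

/-- The `i`-th vertex of a block. -/
def blockVertex (b : ℤ × Fin 3) (i : Fin 6) : ℤ × Fin 14 :=
  (b.1 + vertexOffset b.2 i, vertexType b.2 i)

lemma vertexType_injective : ∀ c i j, vertexType c i = vertexType c j → i = j := by decide

lemma blockVertex_injective (b : ℤ × Fin 3) : Function.Injective (blockVertex b) := fun i j h =>
  vertexType_injective b.2 i j (congrArg Prod.snd h)

lemma ne_add_three : ∀ i j : Fin 6, j ≠ i + 3 → i ≠ j + 3 := by decide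

/-- The infinite tube of octahedra. -/
def octahedronTube : SimpleGraph (ℤ × Fin 14) where
  Adj u v := ∃ b i j, i ≠ j ∧ j ≠ i + 3 ∧ u = blockVertex b i ∧ v = blockVertex b j
  symm := ⟨by
    rintro u v ⟨b, i, j, hij, h3, hu, hv⟩
    exact ⟨b, j, i, hij.symm, ne_add_three i j h3, hv, hu⟩⟩
  loopless := ⟨by
    rintro u ⟨b, i, j, hij, -, hu, hv⟩
    exact hij (blockVertex_injective b (hu.symm.trans hv))⟩

lemma exists_edge_rep {e : Sym2 (ℤ × Fin 14)} (he : e ∈ octahedronTube.edgeSet) :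
    ∃ b, ∃ p ∈ octahedronEdges, e = s(blockVertex b p.1, blockVertex b p.2) := by
  induction e using Sym2.ind with
  | _ u v =>
    obtain ⟨b, i, j, hij, h3, rfl, rfl⟩ := he
    rcases lt_or_gt_of_ne hij with h | h
    · exact ⟨b, (i, j), by simp [octahedronEdges, h, h3], rfl⟩
    · refine ⟨b, (j, i), ?_, Sym2.eq_swap⟩
      simp [octahedronEdges, h, ne_add_three i j h3]

lemma edge_mem (b : ℤ × Fin 3) {p : Fin 6 × Fin 6} (hp : p ∈ octahedronEdges) :
    s(blockVertex b p.1, blockVertex b p.2) ∈ octahedronTube.edgeSet := by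
  simp only [octahedronEdges, Finset.mem_filter, Finset.mem_univ, true_and] at hp
  exact ⟨b, p.1, p.2, hp.1.ne, hp.2, rfl, rfl⟩

/-! ### Short closed walks between blocks -/

/-- The blocks that share a vertex with the block `(0, c)`, with the shared vertex. -/
def neighbours : Fin 3 → List ((ℤ × Fin 3) × (ℤ × Fin 14)) :=
  ![[((0, 1), (0, 0)), ((-2, 1), (0, 1)), ((1, 2), (1, 2))],
    [((0, 0), (0, 0)), ((0, 2), (0, 3)), ((2, 0), (2, 1))],
    [((-1, 0), (0, 2)), ((0, 1), (0, 3))]]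

/-- Walks from the block `(0, c)` through `t + 1` shared vertices with no vertex used
twice in succession: their last blocks and last shared vertices. -/
def walkEnds (c : Fin 3) : ℕ → List ((ℤ × Fin 3) × (ℤ × Fin 14))
  | 0 => neighbours c
  | t + 1 => (walkEnds c t).flatMap fun st =>
      ((neighbours st.1.2).map fun p =>
        ((st.1.1 + p.1.1, p.1.2), (st.1.1 + p.2.1, p.2.2))).filter fun q => q.2 ≠ st.2

/-- By translation it suffices to start in cell 0. The bound 7 is sharp for hexagons, which close up
after 8 shared vertices; the enumeration takes place on the tube, so it covers winding walks too. -/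
lemma walkEnds_not_closed :
    ∀ c : Fin 3, ∀ t < 7, ∀ st ∈ walkEnds c t, st.1 ≠ (0, c) := by
  decide +kernel

lemma mem_neighbours {b b' : ℤ × Fin 3} (hb : b ≠ b') {v : ℤ × Fin 14}
    (hv : v ∈ Set.range (blockVertex b)) (hv' : v ∈ Set.range (blockVertex b')) :
    ((b'.1 - b.1, b'.2), (v.1 - b.1, v.2)) ∈ neighbours b.2 := by
  have key : ∀ c c' i i', vertexType c i = vertexType c' i' →
      (vertexOffset c i = vertexOffset c' i' ∧ c = c') ∨
      ((vertexOffset c i - vertexOffset c' i', c'), (vertexOffset c i, vertexType c i)) ∈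
        neighbours c := by decide +kernel
  obtain ⟨i, rfl⟩ := hv
  obtain ⟨i', hi'⟩ := hv'
  have h1 : b'.1 + vertexOffset b'.2 i' = b.1 + vertexOffset b.2 i := congrArg Prod.fst hi'
  have h2 : vertexType b'.2 i' = vertexType b.2 i := congrArg Prod.snd hi'
  rcases key b.2 b'.2 i i' h2.symm with ⟨h, hc⟩ | h
  · exact absurd (Prod.ext (by omega) hc) hb
  · have e1 : b'.1 - b.1 = vertexOffset b.2 i - vertexOffset b'.2 i' := by omega
    have e2 : (blockVertex b i).1 - b.1 = vertexOffset b.2 i := by simp [blockVertex]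
    rw [e1, e2]
    exact h

/-- Steps that stay in a block are dropped; each real change of block extends a walk of `walkEnds`.
Distinctness of the `x i` is what rules out using a shared vertex twice in succession. -/
lemma block_walk {β : ℕ → ℤ × Fin 3} {x : ℕ → ℤ × Fin 14} {L : ℕ}
    (hx : ∀ i < L, x (i + 1) ∈ Set.range (blockVertex (β i)))
    (hx' : ∀ i < L, x (i + 1) ∈ Set.range (blockVertex (β (i + 1))))
    (hinj : ∀ i j, 1 ≤ i → i < j → j ≤ L → x i ≠ x j) :
    ∀ n ≤ L, (∀ i ≤ n, β i = β 0) ∨ ∃ t < n, ∃ i, 1 ≤ i ∧ i ≤ n ∧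
      (((β n).1 - (β 0).1, (β n).2), ((x i).1 - (β 0).1, (x i).2)) ∈ walkEnds (β 0).2 t := by
  intro n
  induction n with
  | zero => intro _; left; intro i hi; rw [Nat.le_zero.1 hi]
  | succ n ih =>
    intro hn
    by_cases hb : β n = β (n + 1)
    · rcases ih (by omega) with h | ⟨t, ht, i, h1, h2, h3⟩
      · left
        intro i hi
        rcases Nat.lt_or_ge n i with h' | h'
        · rw [show i = n + 1 by omega, ← hb, h n le_rfl]
        · exact h i h'
      · right
        exact ⟨t, by omega, i, h1, by omega, by rwa [← hb]⟩
    · have hnb := mem_neighbours hb (hx n (by omega)) (hx' n (by omega))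
      right
      rcases ih (by omega) with h | ⟨t, ht, i, h1, h2, h3⟩
      · refine ⟨0, by omega, n + 1, by omega, le_rfl, ?_⟩
        rw [h n le_rfl] at hnb
        exact hnb
      · refine ⟨t + 1, by omega, n + 1, by omega, le_rfl, ?_⟩
        rw [walkEnds, List.mem_flatMap]
        refine ⟨_, h3, ?_⟩
        rw [List.mem_filter, List.mem_map]
        refine ⟨⟨_, hnb, ?_⟩, ?_⟩
        · simp only [Prod.mk.injEq, and_true]
          constructor <;> omega
        · simp only [ne_eq, decide_eq_true_eq, Prod.mk.injEq, not_and]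
          intro h4 h5
          exact hinj i (n + 1) h1 (by omega) hn (Prod.ext (by omega) h5.symm)

lemma closed_block_walk {β : ℕ → ℤ × Fin 3} {x : ℕ → ℤ × Fin 14} {L : ℕ} (hL : L ≤ 7)
    (hx : ∀ i < L, x (i + 1) ∈ Set.range (blockVertex (β i)))
    (hx' : ∀ i < L, x (i + 1) ∈ Set.range (blockVertex (β (i + 1))))
    (hinj : ∀ i j, 1 ≤ i → i < j → j ≤ L → x i ≠ x j) (hβ : β L = β 0) :
    ∀ i ≤ L, β i = β 0 := by
  rcases block_walk hx hx' hinj L le_rfl with h | ⟨t, ht, i, -, -, h⟩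
  · exact h
  · exact absurd (by simp [hβ]) (walkEnds_not_closed _ t (by omega) _ h)

/-- Two blocks share at most one vertex. -/
lemma block_eq_of_two_vertices {b b' : ℤ × Fin 3} {u v : ℤ × Fin 14} (huv : u ≠ v)
    (hu : u ∈ Set.range (blockVertex b)) (hv : v ∈ Set.range (blockVertex b))
    (hu' : u ∈ Set.range (blockVertex b')) (hv' : v ∈ Set.range (blockVertex b')) : b' = b := by
  -- The walk `b`, `b'`, `b` through `u` and then `v`.
  refine closed_block_walk (β := fun i => if i = 1 then b' else b)
    (x := fun i => if i = 1 then u else v) (L := 2) (by norm_num) ?_ ?_ ?_ rfl 1 (by norm_num)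
  · intro i hi; interval_cases i <;> simpa
  · intro i hi; interval_cases i <;> simpa
  · intro i j h1 h2 h3
    obtain rfl : i = 1 := by omega
    obtain rfl : j = 2 := by omega
    simpa

/-- The three edges of a triangle lie in the same block. -/
lemma triangle_block {u v w : ℤ × Fin 14} (huv : u ≠ v) (hvw : v ≠ w) (huw : u ≠ w)
    {a b c : ℤ × Fin 3}
    (hua : u ∈ Set.range (blockVertex a)) (hva : v ∈ Set.range (blockVertex a))
    (hvb : v ∈ Set.range (blockVertex b)) (hwb : w ∈ Set.range (blockVertex b))
    (hwc : w ∈ Set.range (blockVertex c)) (huc : u ∈ Set.range (blockVertex c)) :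
    b = a ∧ c = a := by
  have key := closed_block_walk (β := fun i => if i = 1 then b else if i = 2 then c else a)
    (x := fun i => if i = 1 then v else if i = 2 then w else u) (L := 3) (by norm_num)
    (by intro i hi; interval_cases i <;> simpa)
    (by intro i hi; interval_cases i <;> simpa)
    (by
      intro i j h1 h2 h3
      have : i < 3 := by omega
      interval_cases i <;> interval_cases j <;> simp_all [eq_comm])
    rfl
  exact ⟨key 1 (by norm_num), key 2 (by norm_num)⟩

/-! ### Excluding the 7-cycle and `K_4` -/

lemma octahedronTube_cycle_free : (SimpleGraph.cycleGraph 7).Free octahedronTube := by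
  rintro ⟨f⟩
  have hadj : ∀ i : Fin 7, octahedronTube.Adj (f i) (f (i + 1)) := fun i =>
    f.toHom.map_adj (by rw [SimpleGraph.cycleGraph_adj]; right; simp)
  choose β p q _ _ hp hq using hadj
  have key := closed_block_walk (β := fun i : ℕ => β (Fin.ofNat 7 i))
    (x := fun i : ℕ => f (Fin.ofNat 7 i)) (L := 7) le_rfl
    (by
      intro i hi
      refine ⟨q (Fin.ofNat 7 i), ?_⟩
      rw [← hq]
      interval_cases i <;> rfl)
    (fun i _ => ⟨p (Fin.ofNat 7 (i + 1)), (hp _).symm⟩)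
    (by
      intro i j h1 h2 h3 h
      have := congrArg Fin.val (f.injective h)
      simp only [Fin.ofNat] at this
      omega)
    rfl
  have hβ : ∀ i, f i = blockVertex (β 0) (p i) := by
    intro i
    have := key i.val (by omega)
    simp only [Fin.ofNat_eq_cast, Fin.cast_val_eq_self] at this
    rw [hp i, this]
    rfl
  have : Function.Injective p := fun i j h => f.injective (by
    change f i = f j
    rw [hβ, hβ, h])
  simpa using Fintype.card_le_of_injective p this

lemma octahedronTube_complete_free :
    (SimpleGraph.completeGraph (Fin 4)).Free octahedronTube := by
  rintro ⟨f⟩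
  have hadj : ∀ i j : Fin 4, i ≠ j → octahedronTube.Adj (f i) (f j) := fun i j h =>
    f.toHom.map_adj h
  have hne : ∀ i j : Fin 4, i ≠ j → f i ≠ f j := fun i j h h' => h (f.injective h')
  choose! β p q h1 h2 hp hq using hadj
  have mp : ∀ i j, i ≠ j → f i ∈ Set.range (blockVertex (β i j)) := fun i j h =>
    ⟨_, (hp i j h).symm⟩
  have mq : ∀ i j, i ≠ j → f j ∈ Set.range (blockVertex (β i j)) := fun i j h =>
    ⟨_, (hq i j h).symm⟩
  have tri : ∀ i j k, i ≠ j → j ≠ k → i ≠ k → β j k = β i j ∧ β k i = β i j :=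
    fun i j k hij hjk hik => triangle_block (hne i j hij) (hne j k hjk) (hne i k hik)
      (mp _ _ hij) (mq _ _ hij) (mp _ _ hjk) (mq _ _ hjk) (mp _ _ hik.symm) (mq _ _ hik.symm)
  have hβ : ∀ i j, i ≠ j → β i j = β 0 1 := by
    have hs : ∀ i j, i ≠ j → β i j = β j i := fun i j h =>
      block_eq_of_two_vertices (hne j i h.symm) (mp j i h.symm) (mq j i h.symm)
        (mq i j h) (mp i j h)
    have h0 : ∀ j, j ≠ 0 → β 0 j = β 0 1 := by
      intro j hj
      by_cases h : j = 1
      · rw [h]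
      · rw [hs 0 j hj.symm]
        exact (tri 0 1 j (by decide) (Ne.symm h) hj.symm).2
    intro i j hij
    by_cases hi : i = 0
    · subst hi
      exact h0 j hij.symm
    · by_cases hj : j = 0
      · subst hj
        rw [hs i 0 hij, h0 i hi]
      · rw [(tri 0 i j (Ne.symm hi) hij (Ne.symm hj)).1, h0 i hi]
  have hf : ∀ i, ∃ k, f i = blockVertex (β 0 1) k := by
    intro i
    by_cases hi : i = 0
    · exact ⟨p 0 1, by rw [hi, ← hp 0 1 (by decide)]⟩
    · exact ⟨p i 0, by rw [← hβ i 0 hi, ← hp i 0 hi]⟩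
  choose g hg using hf
  have hgadj : ∀ i j, i ≠ j → g i ≠ g j ∧ g j ≠ g i + 3 := by
    intro i j hij
    have e1 : g i = p i j := blockVertex_injective (β 0 1) (by
      rw [← hg, ← hβ i j hij]; exact hp i j hij)
    have e2 : g j = q i j := blockVertex_injective (β 0 1) (by
      rw [← hg, ← hβ i j hij]; exact hq i j hij)
    rw [e1, e2]
    exact ⟨h1 i j hij, h2 i j hij⟩
  -- Among four vertices of an octahedron two are opposite, as there are only three opposite pairs.
  have no : ∀ a b c d : Fin 6, ¬ ((a ≠ b ∧ b ≠ a + 3) ∧ (a ≠ c ∧ c ≠ a + 3) ∧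
      (a ≠ d ∧ d ≠ a + 3) ∧ (b ≠ c ∧ c ≠ b + 3) ∧ (b ≠ d ∧ d ≠ b + 3) ∧
      (c ≠ d ∧ d ≠ c + 3)) := by decide +kernel
  exact no (g 0) (g 1) (g 2) (g 3) ⟨hgadj _ _ (by decide), hgadj _ _ (by decide),
    hgadj _ _ (by decide), hgadj _ _ (by decide), hgadj _ _ (by decide), hgadj _ _ (by decide)⟩
/-! ### A drawing on a cylinder, rolled up to the plane -/

/-- The position of a vertex of each type in the cell `(0, 0)`; cells are squares of side
`100`. -/
def typePosition : Fin 14 → ℤ × ℤ :=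
  ![(54, 46), (50, 3), (-12, 45), (13, 57), (66, 28), (68, 36), (59, 29), (36, 73), (44, 71),
    (37, 62), (-2, 73), (2, 61), (-3, 59), (0, 55)]

/-- The position of the `i`-th vertex of a block of type `c` in the cell `z`. -/
def cellPosition (z : ℤ × ℤ) (c : Fin 3) (i : Fin 6) : ℤ × ℤ :=
  ((typePosition (vertexType c i)).1 + 100 * (vertexCell c i).1 + 100 * z.1,
    (typePosition (vertexType c i)).2 + 100 * (vertexCell c i).2 + 100 * z.2)

/-- Twice the oriented area of a triangle. -/
def orientedArea (P Q R : ℤ × ℤ) : ℤ :=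
  (Q.1 - P.1) * (R.2 - P.2) - (Q.2 - P.2) * (R.1 - P.1)

/-- A sufficient condition for the segments `PQ` and `RS` to meet in common ends only. -/
def MeetInEnds (P Q R S : ℤ × ℤ) : Prop :=
  0 < orientedArea P Q R * orientedArea P Q S ∨ 0 < orientedArea R S P * orientedArea R S Q ∨
  (orientedArea P Q R = 0 ∧ orientedArea P Q S ≠ 0 ∧ (R = P ∨ R = Q)) ∨
  (orientedArea P Q S = 0 ∧ orientedArea P Q R ≠ 0 ∧ (S = P ∨ S = Q))

instance (P Q R S : ℤ × ℤ) : Decidable (MeetInEnds P Q R S) := by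
  unfold MeetInEnds; infer_instance

lemma meetInEnds_near : ∀ c c' : Fin 3, ∀ e ∈ octahedronEdges, ∀ f ∈ octahedronEdges,
    ∀ x ∈ [-1, 0, 1], ∀ y ∈ [-1, 0, 1], (c, e, (0, 0)) = (c', f, (x, y)) ∨
      MeetInEnds (cellPosition (0, 0) c e.1) (cellPosition (0, 0) c e.2)
        (cellPosition (x, y) c' f.1) (cellPosition (x, y) c' f.2) := by
  decide +kernel

/-- The box has the side 100 of a cell, so edges whose cells differ by 2 or more in a coordinate
cannot meet; this leaves the nine relative cells of `meetInEnds_near`. -/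
lemma cellPosition_bounds : ∀ c i, -12 ≤ (cellPosition (0, 0) c i).1 ∧
    (cellPosition (0, 0) c i).1 ≤ 88 ∧ 3 ≤ (cellPosition (0, 0) c i).2 ∧
    (cellPosition (0, 0) c i).2 ≤ 103 := by
  decide +kernel

lemma cellPosition_ne : ∀ c, ∀ e ∈ octahedronEdges,
    cellPosition (0, 0) c e.1 ≠ cellPosition (0, 0) c e.2 := by
  decide +kernel

/-- A lattice point as a complex number. -/
def latticePoint (P : ℤ × ℤ) : ℂ := ⟨P.1, P.2⟩

lemma ends_of_eq_left {p1 p2 q1 q2 t : ℝ} (hne : ¬ (p1 = q1 ∧ p2 = q2))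
    (h1 : (1 - t) * p1 + t * q1 = p1) (h2 : (1 - t) * p2 + t * q2 = p2) : t = 0 := by
  by_contra ht
  exact hne ⟨mul_left_cancel₀ ht (by linarith), mul_left_cancel₀ ht (by linarith)⟩

lemma ends_of_eq_right {p1 p2 q1 q2 t : ℝ} (hne : ¬ (p1 = q1 ∧ p2 = q2))
    (h1 : (1 - t) * p1 + t * q1 = q1) (h2 : (1 - t) * p2 + t * q2 = q2) : t = 1 := by
  by_contra ht
  have ht : 1 - t ≠ 0 := fun h => ht (by linarith)
  exact hne ⟨mul_left_cancel₀ ht (by linarith), mul_left_cancel₀ ht (by linarith)⟩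

lemma convex_comb_ne_zero {a b t : ℝ} (h : 0 < a * b) (h0 : 0 ≤ t) (h1 : t ≤ 1)
    (he : (1 - t) * a + t * b = 0) : False := by
  have ha : a ≠ 0 := by rintro rfl; simp at h
  have e : (1 - t) * a ^ 2 + t * (a * b) = 0 := by linear_combination a * he
  have p1 : 0 ≤ (1 - t) * a ^ 2 := mul_nonneg (by linarith) (sq_nonneg a)
  have p2 : 0 ≤ t * (a * b) := mul_nonneg h0 h.le
  have : t * (a * b) = 0 := by linarith
  rcases mul_eq_zero.1 this with rfl | h'
  · have : a ^ 2 = 0 := by linarith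
    exact ha (by simpa using this)
  · linarith

/-- Segments that satisfy `MeetInEnds` meet in common ends only. -/
lemma MeetInEnds.ends {P Q R S : ℤ × ℤ} (h : MeetInEnds P Q R S) {s t : ℝ}
    (hs : s ∈ Set.Icc (0 : ℝ) 1) (ht : t ∈ Set.Icc (0 : ℝ) 1)
    (h1 : (1 - s) * (P.1 : ℝ) + s * Q.1 = (1 - t) * R.1 + t * S.1)
    (h2 : (1 - s) * (P.2 : ℝ) + s * Q.2 = (1 - t) * R.2 + t * S.2) :
    (s = 0 ∨ s = 1) ∧ (t = 0 ∨ t = 1) := by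
  -- The oriented area is affine in its third point and vanishes at the common point, which lies on
  -- the line `PQ`.
  have e1 : (1 - t) * (orientedArea P Q R : ℝ) + t * orientedArea P Q S = 0 := by
    simp only [orientedArea]
    push_cast
    linear_combination (-((Q.1 : ℝ) - P.1)) * h2 + ((Q.2 : ℝ) - P.2) * h1
  have e2 : (1 - s) * (orientedArea R S P : ℝ) + s * orientedArea R S Q = 0 := by
    simp only [orientedArea]
    push_cast
    linear_combination ((S.1 : ℝ) - R.1) * h2 - ((S.2 : ℝ) - R.2) * h1
  have hPQ : ∀ X, orientedArea P Q X ≠ 0 → ¬ ((P.1 : ℝ) = Q.1 ∧ (P.2 : ℝ) = Q.2) := by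
    rintro X hX ⟨a, b⟩
    apply hX
    have a : P.1 = Q.1 := by exact_mod_cast a
    have b : P.2 = Q.2 := by exact_mod_cast b
    simp [orientedArea, a, b]
  rcases h with h | h | ⟨h0, hne, h⟩ | ⟨h0, hne, h⟩
  · exact (convex_comb_ne_zero (by exact_mod_cast h) ht.1 ht.2 e1).elim
  · exact (convex_comb_ne_zero (by exact_mod_cast h) hs.1 hs.2 e2).elim
  · have ht0 : t = 0 := by
      rw [h0] at e1
      have : (orientedArea P Q S : ℝ) ≠ 0 := by exact_mod_cast hne
      simpa [this] using e1
    subst ht0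
    refine ⟨?_, Or.inl rfl⟩
    rcases h with rfl | rfl
    · exact Or.inl (ends_of_eq_left (hPQ S hne) (by linarith) (by linarith))
    · exact Or.inr (ends_of_eq_right (hPQ S hne) (by linarith) (by linarith))
  · have ht1 : t = 1 := by
      rw [h0] at e1
      have : (orientedArea P Q R : ℝ) ≠ 0 := by exact_mod_cast hne
      have : 1 - t = 0 := by simpa [this] using e1
      linarith
    subst ht1
    refine ⟨?_, Or.inr rfl⟩
    rcases h with rfl | rfl
    · exact Or.inl (ends_of_eq_left (hPQ R hne) (by linarith) (by linarith))
    · exact Or.inr (ends_of_eq_right (hPQ R hne) (by linarith) (by linarith))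

lemma near_of_bounds {p q r s a b : ℝ} {x m : ℤ} (ha : a ∈ Set.Icc (0 : ℝ) 1)
    (hb : b ∈ Set.Icc (0 : ℝ) 1)
    (hp : m ≤ p ∧ p ≤ m + 100) (hq : m ≤ q ∧ q ≤ m + 100)
    (hr : m ≤ r ∧ r ≤ m + 100) (hs : m ≤ s ∧ s ≤ m + 100)
    (h : (1 - a) * p + a * q = (1 - b) * (r + 100 * x) + b * (s + 100 * x)) :
    x ∈ [-1, 0, 1] := by
  obtain ⟨ha0, ha1⟩ := ha
  obtain ⟨hb0, hb1⟩ := hb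
  have l1 : (m : ℝ) ≤ (1 - a) * p + a * q := by nlinarith
  have l2 : (1 - a) * p + a * q ≤ m + 100 := by nlinarith
  have l3 : (m : ℝ) ≤ (1 - b) * r + b * s := by nlinarith
  have l4 : (1 - b) * r + b * s ≤ m + 100 := by nlinarith
  have u1 : (x : ℝ) ≤ 1 := by linarith
  have u2 : (-1 : ℝ) ≤ x := by linarith
  have u1 : x ≤ 1 := by exact_mod_cast u1
  have u2 : -1 ≤ x := by exact_mod_cast u2
  simp only [List.mem_cons, List.not_mem_nil, or_false]
  omega

/-- In the lattice-periodic drawing of the universal cover, distinct edges meet in ends only. -/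
lemma lattice_drawing {c c' : Fin 3} {e f : Fin 6 × Fin 6} (he : e ∈ octahedronEdges)
    (hf : f ∈ octahedronEdges) (z : ℤ × ℤ) {s t : ℝ}
    (hs : s ∈ Set.Icc (0 : ℝ) 1) (ht : t ∈ Set.Icc (0 : ℝ) 1)
    (h : (1 - s) * latticePoint (cellPosition (0, 0) c e.1) +
      s * latticePoint (cellPosition (0, 0) c e.2) =
      (1 - t) * latticePoint (cellPosition z c' f.1) + t * latticePoint (cellPosition z c' f.2)) :
    (c = c' ∧ e = f ∧ z = 0 ∧ s = t) ∨ (s = 0 ∨ s = 1) ∧ (t = 0 ∨ t = 1) := by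
  have h1 := congrArg Complex.re h
  have h2 := congrArg Complex.im h
  simp only [latticePoint, Complex.add_re, Complex.mul_re, Complex.sub_re, Complex.one_re,
    Complex.ofReal_re, Complex.sub_im, Complex.one_im, Complex.ofReal_im, Complex.add_im,
    Complex.mul_im, sub_self, zero_mul, sub_zero, add_zero] at h1 h2
  have hz : ∀ i, cellPosition z c' i = ((cellPosition (0, 0) c' i).1 + 100 * z.1,
      (cellPosition (0, 0) c' i).2 + 100 * z.2) := by
    intro i; simp [cellPosition]
  have B : ∀ c i, (((-12 : ℤ) : ℝ) ≤ (cellPosition (0, 0) c i).1 ∧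
      ((cellPosition (0, 0) c i).1 : ℝ) ≤ (-12 : ℤ) + 100) ∧
      (((3 : ℤ) : ℝ) ≤ (cellPosition (0, 0) c i).2 ∧
      ((cellPosition (0, 0) c i).2 : ℝ) ≤ (3 : ℤ) + 100) := by
    intro c i
    obtain ⟨b1, b2, b3, b4⟩ := cellPosition_bounds c i
    refine ⟨⟨by exact_mod_cast b1, ?_⟩, by exact_mod_cast b3, ?_⟩
    · have : (cellPosition (0, 0) c i).1 ≤ -12 + 100 := by omega
      exact_mod_cast this
    · have : (cellPosition (0, 0) c i).2 ≤ 3 + 100 := by omega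
      exact_mod_cast this
  have x1 : z.1 ∈ [-1, 0, 1] := by
    have h1 := h1
    rw [hz, hz] at h1
    push_cast at h1
    exact near_of_bounds hs ht (B _ _).1 (B _ _).1 (B _ _).1 (B _ _).1 h1
  have x2 : z.2 ∈ [-1, 0, 1] := by
    have h2 := h2
    rw [hz, hz] at h2
    push_cast at h2
    exact near_of_bounds hs ht (B _ _).2 (B _ _).2 (B _ _).2 (B _ _).2 h2
  rcases meetInEnds_near c c' e he f hf z.1 x1 z.2 x2 with heq | hm
  · left
    simp only [Prod.mk.injEq] at heq
    obtain ⟨rfl, rfl, z1, z2⟩ := heq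
    have hz0 : z = (0, 0) := Prod.ext z1.symm z2.symm
    refine ⟨rfl, rfl, hz0, ?_⟩
    subst hz0
    by_contra hst
    have hst : t - s ≠ 0 := sub_ne_zero.2 (Ne.symm hst)
    apply cellPosition_ne c e he
    apply Prod.ext
    · have : ((cellPosition (0, 0) c e.1).1 : ℝ) = (cellPosition (0, 0) c e.2).1 :=
        mul_left_cancel₀ hst (by linarith)
      exact_mod_cast this
    · have : ((cellPosition (0, 0) c e.1).2 : ℝ) = (cellPosition (0, 0) c e.2).2 :=
        mul_left_cancel₀ hst (by linarith)
      exact_mod_cast this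
  · right
    exact hm.ends hs ht (by linarith) (by linarith)

/-! ### Passing from the periodic drawing to the plane -/

/-- Rolling up the plane along the vector `(200, -100)`. -/
noncomputable def rollUp (z : ℂ) : EuclideanSpace ℝ (Fin 2) :=
  Complex.orthonormalBasisOneI.repr
    (Complex.exp (2 * Real.pi * Complex.I * (z / (200 - 100 * Complex.I))))

lemma continuous_rollUp : Continuous rollUp := by
  unfold rollUp
  fun_prop

lemma period_ne_zero : (200 - 100 * Complex.I : ℂ) ≠ 0 := by
  intro h
  have := congrArg Complex.re h
  norm_num at this

lemma rollUp_eq_iff {z w : ℂ} :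
    rollUp z = rollUp w ↔ ∃ k : ℤ, z = w + k * (200 - 100 * Complex.I) := by
  have hp := period_ne_zero
  have hpi : (2 * Real.pi * Complex.I : ℂ) ≠ 0 := Complex.two_pi_I_ne_zero
  unfold rollUp
  rw [EmbeddingLike.apply_eq_iff_eq, Complex.exp_eq_exp_iff_exists_int]
  refine exists_congr fun k => ?_
  rw [show 2 * Real.pi * Complex.I * (w / (200 - 100 * Complex.I)) +
      k * (2 * Real.pi * Complex.I) =
      2 * Real.pi * Complex.I * (w / (200 - 100 * Complex.I) + k) by ring,
    mul_right_inj' hpi, div_eq_iff hp, add_mul, div_mul_cancel₀ _ hp]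

/-- The point of the plane that represents a vertex of the tube. -/
noncomputable def tubePoint (v : ℤ × Fin 14) : EuclideanSpace ℝ (Fin 2) :=
  rollUp (latticePoint ((typePosition v.2).1 + 100 * v.1, (typePosition v.2).2))

/-- The arc that represents an edge of the tube. -/
noncomputable def tubeArc (b : ℤ × Fin 3) (e : Fin 6 × Fin 6) :
    C(unitInterval, EuclideanSpace ℝ (Fin 2)) where
  toFun t := rollUp ((1 - ((t : ℝ) : ℂ)) * latticePoint (cellPosition (b.1, 0) b.2 e.1) +
    ((t : ℝ) : ℂ) * latticePoint (cellPosition (b.1, 0) b.2 e.2))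
  continuous_toFun := continuous_rollUp.comp (by fun_prop)

lemma rollUp_cellPosition (b : ℤ × Fin 3) (i : Fin 6) :
    rollUp (latticePoint (cellPosition (b.1, 0) b.2 i)) = tubePoint (blockVertex b i) := by
  rw [tubePoint, rollUp_eq_iff]
  -- The cell `(x, y)` equals `(x + 2y, 0)` minus `y` periods `(2, -1)`.
  refine ⟨-(vertexCell b.2 i).2, ?_⟩
  apply Complex.ext
  · simp [latticePoint, cellPosition, blockVertex, vertexOffset]
    ring
  · simp [latticePoint, cellPosition, blockVertex]
    ring

lemma tubeArc_zero (b : ℤ × Fin 3) (e : Fin 6 × Fin 6) :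
    tubeArc b e 0 = tubePoint (blockVertex b e.1) := by
  rw [← rollUp_cellPosition]
  simp [tubeArc]

lemma tubeArc_one (b : ℤ × Fin 3) (e : Fin 6 × Fin 6) :
    tubeArc b e 1 = tubePoint (blockVertex b e.2) := by
  rw [← rollUp_cellPosition]
  simp [tubeArc]

lemma tubePoint_injective : Function.Injective tubePoint := by
  intro u v h
  obtain ⟨k, hk⟩ := rollUp_eq_iff.1 h
  have h1 := congrArg Complex.re hk
  have h2 := congrArg Complex.im hk
  simp [latticePoint] at h1 h2
  have h1 : (typePosition u.2).1 + 100 * u.1 = (typePosition v.2).1 + 100 * v.1 + k * 200 := by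
    apply Int.cast_injective (α := ℝ)
    push_cast
    exact h1
  have h2 : (typePosition u.2).2 = (typePosition v.2).2 + -(k * 100) := by
    apply Int.cast_injective (α := ℝ)
    push_cast
    exact h2
  -- Positions of distinct types differ modulo the lattice; once the types agree, the second
  -- coordinate gives `k = 0`.
  have sep : ∀ i j, ((typePosition i).1 - (typePosition j).1) % 100 = 0 →
      ((typePosition i).2 - (typePosition j).2) % 100 = 0 → i = j := by decide +kernel
  have h3 : u.2 = v.2 := sep _ _ (by omega) (by omega)
  rw [h3] at h1 h2
  exact Prod.ext (by omega) h3

lemma tubeArc_eq {b b' : ℤ × Fin 3} {e f : Fin 6 × Fin 6} (he : e ∈ octahedronEdges)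
    (hf : f ∈ octahedronEdges) {s t : unitInterval} (h : tubeArc b e s = tubeArc b' f t) :
    (b = b' ∧ e = f ∧ s = t) ∨ (s = 0 ∨ s = 1) ∧ (t = 0 ∨ t = 1) := by
  obtain ⟨k, hk⟩ := rollUp_eq_iff.1 h
  have hb : ∀ c i, latticePoint (cellPosition (b.1, 0) c i) =
      latticePoint (cellPosition (0, 0) c i) + 100 * b.1 := by
    intro c i
    apply Complex.ext <;> simp [latticePoint, cellPosition]
  -- Moving the second edge by `k` periods and both edges by `-b.1` cells puts the first one in cell
  -- `(0, 0)`, as `lattice_drawing` requires.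
  have hb' : ∀ c i, latticePoint (cellPosition (b'.1, 0) c i) =
      latticePoint (cellPosition (b'.1 - b.1 + 2 * k, -k) c i) + 100 * b.1 -
        k * (200 - 100 * Complex.I) := by
    intro c i
    apply Complex.ext
    · simp [latticePoint, cellPosition]
      ring
    · simp [latticePoint, cellPosition]
      ring
  rw [hb, hb, hb', hb'] at hk
  have := lattice_drawing (c := b.2) (c' := b'.2) he hf (b'.1 - b.1 + 2 * k, -k) s.2 t.2
    (by linear_combination hk)
  simp only [Prod.mk_eq_zero, Set.Icc.coe_eq_zero, Set.Icc.coe_eq_one] at this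
  rcases this with ⟨h1, h2, ⟨h3, h4⟩, h5⟩ | h
  · exact Or.inl ⟨Prod.ext (by omega) h1, h2, Subtype.ext h5⟩
  · exact Or.inr h

lemma tubeArc_injective (b : ℤ × Fin 3) {e : Fin 6 × Fin 6} (he : e ∈ octahedronEdges) :
    Function.Injective (tubeArc b e) := by
  intro s t h
  have hne : tubeArc b e 0 ≠ tubeArc b e 1 := by
    rw [tubeArc_zero, tubeArc_one]
    intro h'
    have := blockVertex_injective b (tubePoint_injective h')
    simp only [octahedronEdges, Finset.mem_filter] at he
    exact he.2.1.ne this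
  rcases tubeArc_eq he he h with ⟨-, -, h'⟩ | ⟨rfl | rfl, rfl | rfl⟩
  · exact h'
  · rfl
  · exact absurd h hne
  · exact absurd h.symm hne
  · rfl

lemma tubeArc_mem_range {b : ℤ × Fin 3} {e : Fin 6 × Fin 6} {t : unitInterval}
    (ht : t = 0 ∨ t = 1) : tubeArc b e t ∈ Set.range tubePoint := by
  rcases ht with rfl | rfl
  · exact ⟨_, (tubeArc_zero b e).symm⟩
  · exact ⟨_, (tubeArc_one b e).symm⟩

/-- With this, an arc through a vertex point is a case of two arcs that meet. -/
lemma exists_tubeArc_eq_point (v : ℤ × Fin 14) :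
    ∃ b, ∃ e ∈ octahedronEdges, ∃ t : unitInterval, (t = 0 ∨ t = 1) ∧
      tubeArc b e t = tubePoint v := by
  have h : ∀ r : Fin 14, ∃ c, ∃ e ∈ octahedronEdges, vertexType c e.1 = r ∨
      vertexType c e.2 = r := by decide +kernel
  obtain ⟨c, e, he, hr⟩ := h v.2
  rcases hr with hr | hr
  · refine ⟨(v.1 - vertexOffset c e.1, c), e, he, 0, Or.inl rfl, ?_⟩
    rw [tubeArc_zero]
    congr 1
    exact Prod.ext (by simp [blockVertex]) hr
  · refine ⟨(v.1 - vertexOffset c e.2, c), e, he, 1, Or.inr rfl, ?_⟩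
    rw [tubeArc_one]
    congr 1
    exact Prod.ext (by simp [blockVertex]) hr

lemma isPlanar_octahedronTube : IsPlanar octahedronTube := by
  have rep := fun e : octahedronTube.edgeSet => exists_edge_rep e.2
  choose b p hp he using rep
  refine ⟨{
    point := tubePoint
    point_injective := tubePoint_injective
    arc := fun e => tubeArc (b e) (p e)
    arc_injective := fun e => tubeArc_injective (b e) (hp e)
    arc_ends := fun e => by
      rw [he e, tubeArc_zero, tubeArc_one, Sym2.map_mk]
    arc_avoids_points := ?_
    arcs_disjoint := ?_ }⟩
  · rintro e t ⟨v, hv⟩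
    obtain ⟨b', f, hf, t', ht', h⟩ := exists_tubeArc_eq_point v
    rcases tubeArc_eq (hp e) hf (hv.symm.trans h.symm) with ⟨-, -, h⟩ | h
    · rwa [h]
    · exact h.1
  · intro e f hef s t h
    rcases tubeArc_eq (hp e) (hp f) h with ⟨h1, h2, -⟩ | h
    · exact absurd (Subtype.ext (by rw [he e, he f, h1, h2])) hef
    · exact tubeArc_mem_range h.1

/-! ### Planarity of subgraphs -/

/-- A graph that maps injectively into a planar graph is planar. -/
lemma IsPlanar.comap {V W : Type*} {G : SimpleGraph V} {H : SimpleGraph W} (f : G →g H)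
    (hf : Function.Injective f) (h : IsPlanar H) : IsPlanar G := by
  obtain ⟨D⟩ := h
  -- Arcs meet in vertex points of `H`; such a point is an end of its arc, hence comes from a vertex
  -- of `G`.
  have ends : ∀ e : G.edgeSet, ∀ t : unitInterval, t = 0 ∨ t = 1 →
      D.arc (f.mapEdgeSet e) t ∈ Set.range fun v => D.point (f v) := by
    intro e t ht
    have h := D.arc_ends (f.mapEdgeSet e)
    have hm : D.arc (f.mapEdgeSet e) t ∈
        s(D.arc (f.mapEdgeSet e) 0, D.arc (f.mapEdgeSet e) 1) := by
      rcases ht with rfl | rfl <;> simp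
    rw [h] at hm
    obtain ⟨w, hw, hwt⟩ := Sym2.mem_map.1 hm
    obtain ⟨v, -, hv⟩ := Sym2.mem_map.1 (show w ∈ Sym2.map f e from hw)
    exact ⟨v, by simp only [hv, hwt]⟩
  refine ⟨{
    point := fun v => D.point (f v)
    point_injective := D.point_injective.comp hf
    arc := fun e => D.arc (f.mapEdgeSet e)
    arc_injective := fun e => D.arc_injective _
    arc_ends := fun e => by
      rw [D.arc_ends]
      change Sym2.map D.point (Sym2.map f e) = _
      rw [Sym2.map_map]
      rfl
    arc_avoids_points := ?_
    arcs_disjoint := ?_ }⟩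
  · rintro e t ⟨v, hv⟩
    exact D.arc_avoids_points _ t ⟨f v, hv⟩
  · intro e e' hne s t h
    exact ends e s (D.arc_avoids_points _ s (D.arcs_disjoint _ _
      (fun h' => hne (SimpleGraph.Hom.mapEdgeSet.injective f hf h')) s t h))
/-! ### Finite pieces of the tube -/

/-- The number of cells by which the range of the vertices of a type, in the piece of the tube of
length `N`, is shifted at its start and at its end. -/
def vertexMargin : Fin 14 → ℤ × ℤ :=
  ![(0, 0), (0, 2), (1, 1), (0, 0), (0, 0), (0, 0), (0, 0), (0, 0), (0, 0), (0, 0),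
    (1, 0), (1, 0), (1, 0), (1, 0)]

/-- The first index of a block of type `c` in a piece of the tube. -/
def blockStart : Fin 3 → ℤ := ![0, 0, 1]

/-- The vertices of the piece of length `N`. -/
noncomputable def pieceVertices (N : ℕ) : Finset (Σ _ : Fin 14, ℤ) :=
  Finset.univ.sigma fun r => Finset.Ico (vertexMargin r).1 (N + (vertexMargin r).2)

/-- The blocks of the piece of length `N`. -/
noncomputable def pieceBlocks (N : ℕ) : Finset (Σ _ : Fin 3, ℤ) :=
  Finset.univ.sigma fun c => Finset.Ico (blockStart c) N

lemma card_pieceVertices {N : ℕ} (hN : 1 ≤ N) : (pieceVertices N).card = 14 * N - 2 := by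
  simp [pieceVertices, Fin.sum_univ_succ, vertexMargin]
  omega

lemma card_pieceBlocks {N : ℕ} (hN : 1 ≤ N) : (pieceBlocks N).card = 3 * N - 1 := by
  simp [pieceBlocks, Fin.sum_univ_succ, blockStart]
  omega

/-- The edges of the piece of length `N`. -/
noncomputable def pieceEdges (N : ℕ) : Finset (Sym2 (ℤ × Fin 14)) :=
  (pieceBlocks N ×ˢ octahedronEdges).image fun q =>
    s(blockVertex (q.1.2, q.1.1) q.2.1, blockVertex (q.1.2, q.1.1) q.2.2)

/-- Different blocks have no common edge because they share at most one vertex. -/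
lemma card_pieceEdges {N : ℕ} (hN : 1 ≤ N) : (pieceEdges N).card = 12 * (3 * N - 1) := by
  rw [pieceEdges, Finset.card_image_of_injOn, Finset.card_product,
    card_pieceBlocks hN]
  · rw [show octahedronEdges.card = 12 by decide, mul_comm]
  · rintro ⟨⟨c, m⟩, e⟩ hq ⟨⟨c', m'⟩, f⟩ hq' h
    simp only [Finset.coe_product, Set.mem_prod, Finset.mem_coe, octahedronEdges,
      Finset.mem_filter, Finset.mem_univ, true_and] at hq hq'
    have hne : blockVertex (m, c) e.1 ≠ blockVertex (m, c) e.2 := fun h =>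
      hq.2.1.ne (blockVertex_injective _ h)
    simp only [Sym2.eq_iff] at h
    obtain ⟨h1, h2⟩ : blockVertex (m, c) e.1 ∈ Set.range (blockVertex (m', c')) ∧
        blockVertex (m, c) e.2 ∈ Set.range (blockVertex (m', c')) := by
      rcases h with ⟨h1, h2⟩ | ⟨h1, h2⟩ <;> exact ⟨⟨_, h1.symm⟩, ⟨_, h2.symm⟩⟩
    have hb := block_eq_of_two_vertices hne ⟨_, rfl⟩ ⟨_, rfl⟩ h1 h2
    obtain ⟨rfl, rfl⟩ := Prod.mk.inj hb
    rcases h with ⟨h1, h2⟩ | ⟨h1, h2⟩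
    · have := Prod.ext (blockVertex_injective _ h1) (blockVertex_injective _ h2)
      rw [this]
    · have e1 := blockVertex_injective _ h1
      have e2 := blockVertex_injective _ h2
      have l1 := hq.2.1
      have l2 := hq'.2.1
      rw [e1, e2] at l1
      exact absurd l1 l2.asymm

/-- The margins are chosen so that the two ends of any single edge already impose the index range of
the whole block. Hence the subgraph induced on a piece has no edges from partial blocks. -/
lemma mem_piece_iff {N : ℕ} {m : ℤ} {c : Fin 3} {e : Fin 6 × Fin 6} (he : e ∈ octahedronEdges) :
    ((∀ i, i = e.1 ∨ i = e.2 → (⟨vertexType c i, m + vertexOffset c i⟩ : Σ _ : Fin 14, ℤ) ∈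
      pieceVertices N) ↔ (⟨c, m⟩ : Σ _ : Fin 3, ℤ) ∈ pieceBlocks N) := by
  have key : ∀ c, ∀ e ∈ octahedronEdges,
      max ((vertexMargin (vertexType c e.1)).1 - vertexOffset c e.1)
        ((vertexMargin (vertexType c e.2)).1 - vertexOffset c e.2) = blockStart c ∧
      min ((vertexMargin (vertexType c e.1)).2 - vertexOffset c e.1)
        ((vertexMargin (vertexType c e.2)).2 - vertexOffset c e.2) = 0 := by decide +kernel
  have := key c e he
  simp only [pieceVertices, pieceBlocks, Finset.mem_sigma, Finset.mem_univ, true_and,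
    Finset.mem_Ico, forall_eq_or_imp, forall_eq]
  omega

/-- The inclusion of the vertices of a piece into the tube. -/
def pieceInclusion {N : ℕ} (v : pieceVertices N) : ℤ × Fin 14 := (v.1.2, v.1.1)

lemma pieceInclusion_injective {N : ℕ} : Function.Injective (pieceInclusion (N := N)) := by
  rintro ⟨⟨r, m⟩, h⟩ ⟨⟨r', m'⟩, h'⟩ heq
  obtain ⟨rfl, rfl⟩ := Prod.mk.inj heq
  rfl

lemma image_edgeSet {N : ℕ} {V : Type*} (σ : V ≃ pieceVertices N) :
    Sym2.map (pieceInclusion ∘ σ) '' (octahedronTube.comap (pieceInclusion ∘ σ)).edgeSet =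
      pieceEdges N := by
  ext e
  simp only [Set.mem_image, pieceEdges, Finset.coe_image, Finset.coe_product, Set.mem_prod,
    Finset.mem_coe]
  constructor
  · rintro ⟨d, hd, rfl⟩
    have hd' : Sym2.map (pieceInclusion ∘ σ) d ∈ octahedronTube.edgeSet := by
      induction d using Sym2.ind with
      | _ u v => exact hd
    obtain ⟨b, p, hp, h⟩ := exists_edge_rep hd'
    refine ⟨(⟨b.2, b.1⟩, p), ⟨(mem_piece_iff hp).1 ?_, hp⟩, h.symm⟩
    intro i hi
    have hm : blockVertex b i ∈ Sym2.map (pieceInclusion ∘ σ) d := by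
      rw [h]
      rcases hi with rfl | rfl <;> simp
    obtain ⟨v, -, hv⟩ := Sym2.mem_map.1 hm
    have h1 : (σ v).1.2 = b.1 + vertexOffset b.2 i := congrArg Prod.fst hv
    have h2 : (σ v).1.1 = vertexType b.2 i := congrArg Prod.snd hv
    have h3 := (σ v).2
    rwa [show (σ v).1 = ⟨vertexType b.2 i, b.1 + vertexOffset b.2 i⟩ from by
      rw [← h1, ← h2]] at h3
  · rintro ⟨⟨⟨c, m⟩, p⟩, ⟨hb, hp⟩, rfl⟩
    have hv := (mem_piece_iff (N := N) hp).2 hb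
    have h1 := hv p.1 (Or.inl rfl)
    have h2 := hv p.2 (Or.inr rfl)
    have key : Sym2.map (pieceInclusion ∘ σ) s(σ.symm ⟨_, h1⟩, σ.symm ⟨_, h2⟩) =
        s(blockVertex (m, c) p.1, blockVertex (m, c) p.2) := by
      simp only [Sym2.map_mk, Function.comp_apply, Equiv.apply_symm_apply]
      rfl
    refine ⟨_, ?_, key⟩
    have := edge_mem (m, c) hp
    rw [← key] at this
    exact this

theorem theorem3 (n : ℕ) (hn : 110 ≤ n) (hmod : n ≡ 26 [MOD 42]) :
    ∃ G : SimpleGraph (Fin n),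
      IsPlanar G ∧
      (SimpleGraph.completeGraph (Fin 4)).Free G ∧
      (SimpleGraph.cycleGraph 7).Free G ∧
      (G.edgeSet.ncard : ℚ) = 18 / 7 * (n : ℚ) - 48 / 7 := by
  -- The congruence modulo 42 enters only through its consequence n ≡ -2 modulo 14.
  obtain ⟨N, hN, rfl⟩ : ∃ N : ℕ, 1 ≤ N ∧ n = 14 * N - 2 :=
    ⟨(n + 2) / 14, by omega, by have : n % 42 = 26 := hmod; omega⟩
  let σ : Fin (14 * N - 2) ≃ pieceVertices N :=
    Fintype.equivOfCardEq (by simp [card_pieceVertices hN])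
  have hinj : Function.Injective (pieceInclusion ∘ σ) :=
    pieceInclusion_injective.comp σ.injective
  let φ : octahedronTube.comap (pieceInclusion ∘ σ) →g octahedronTube :=
    ⟨pieceInclusion ∘ σ, fun h => h⟩
  have hle : (octahedronTube.comap (pieceInclusion ∘ σ)).IsContained octahedronTube :=
    ⟨⟨φ, hinj⟩⟩
  refine ⟨octahedronTube.comap (pieceInclusion ∘ σ), isPlanar_octahedronTube.comap φ hinj,
    fun h => octahedronTube_complete_free (h.trans hle),
    fun h => octahedronTube_cycle_free (h.trans hle), ?_⟩
  rw [← Set.ncard_image_of_injective _ (Sym2.map.injective hinj), image_edgeSet,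
    Set.ncard_coe_finset, card_pieceEdges hN, Nat.cast_mul, Nat.cast_sub (by omega),
    Nat.cast_sub (by omega)]
  push_cast
  ring
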